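/- All matroids and graphs are finite. Let $M$ be a matroid with ground set $E$, rank function $r$ and dual $M^\ast$; $M$ is simple if all its circuits have at least three elements, cosimple if $M^\ast$ is simple, and its corank is the rank of $M^\ast$. A gammoid is a matroid for which there are a finite digraph, a set $T$ of its vertices and an injection from $E$ to its vertices such that a subset of $E$ is independent if and only if its image is linked into $T$ by pairwise vertex-disjoint directed paths (possibly trivial). A double circuit is a set $D\subseteq E$ with $r(D)=|D|-2=r(D\setminus\{d\})$ for every $d\in D$; its circuit partition consists of the sets $D\setminus C$, where $C$ runs over the circuits contained in $D$. A coline is a flat $L$ with $r(L)=r(M)-2$; its copoint partition consists of the sets $H\setminus L$, where $H$ runs over the hyperplanes containing $L$. A double circuit (a coline) is positive if its circuit (copoint) partition has more classes with exactly one element than other classes. The bicircular matroid $B(G)$ of a graph $G$ is the matroid on the edge set of $G$ in which a set $I$ is independent if and only if every connected component of the subgraph with edge set $I$ contains at most one cycle. **Corollary.** Not every cosimple gammoid of corank at least two has a positive double circuit. Equivalently, not every simple gammoid of rank at least two has a positive coline. More precisely: 1. There is a cosimple gammoid of corank at least two without positive double circuits, and there is a simple gammoid of rank at least two without positive colines.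 2. A matroid $M$ is a cosimple gammoid of corank at least two without positive double circuits if and only if $M^\ast$ is a simple gammoid of rank at least two without positive colines. 3. If $G$ is a graph of girth at least $5$ (forests have infinite girth), then $B(G)$ has no positive double circuits. If moreover $G$ has an edge and $B(G)$ is cosimple, then $B(G)$ is a cosimple gammoid of corank at least two without positive double circuits, and $B(G)^\ast$ is a simple gammoid of rank at least two without positive colines. 4. The Petersen graph $P$ has girth at least $5$ and $B(P)$ is cosimple, so that $B(P)$ and $B(P)^\ast$ are such matroids. -/

import Mathlib

universe u

namespace Matroid

/-- A matroid is simple if it has neither loops nor parallel pairs, that is, if all its circuits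
have at least three elements. -/
def IsSimple {α : Type u} (M : Matroid α) : Prop :=
  ∀ C, M.IsCircuit C → 3 ≤ C.encard

/-- A matroid is cosimple if its dual is simple. -/
def IsCosimple {α : Type u} (M : Matroid α) : Prop :=
  M✶.IsSimple

/-- The corank of a matroid is the rank of its dual. -/
noncomputable def corank {α : Type u} (M : Matroid α) : ℕ∞ :=
  M✶.eRank

/-! ### Gammoids -/

/-- In the digraph `D`, the vertex set `X` is linked into the vertex set `T`: there are pairwise
vertex-disjoint directed paths, one starting at each `x ∈ X`, all of them ending in `T`.
The path starting at `x` is the list of vertices `x :: p x` (the trivial path is allowed). -/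
def IsLinkedInto {V : Type u} (D : Digraph V) (X T : Set V) : Prop :=
  ∃ p : V → List V,
    (∀ x ∈ X, (x :: p x).Nodup ∧ (x :: p x).IsChain D.Adj ∧
      (x :: p x).getLast (List.cons_ne_nil x (p x)) ∈ T) ∧
    ∀ x ∈ X, ∀ y ∈ X, x ≠ y → List.Disjoint (x :: p x) (y :: p y)

/-- A gammoid: up to the injective labelling `f` of the elements by vertices, the ground set is a
set of vertices of a finite digraph `D`, and the independent sets are the sets of elements that are
linked in `D` into a fixed set `T` of vertices. -/
def IsGammoid {α : Type u} (M : Matroid α) : Prop :=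
  ∃ (V : Type u) (_ : Finite V) (D : Digraph V) (T : Set V) (f : α → V),
    Set.InjOn f M.E ∧ ∀ I ⊆ M.E, (M.Indep I ↔ IsLinkedInto D (f '' I) T)

/-! ### Colines (of matroids of finite rank) -/

/-- A copoint is a hyperplane: a flat of codimension one. -/
def IsCopoint {α : Type u} (M : Matroid α) (H : Set α) : Prop :=
  M.IsFlat H ∧ M.eRk H + 1 = M.eRank

/-- A coline is a flat of codimension two. -/
def IsColine {α : Type u} (M : Matroid α) (L : Set α) : Prop :=
  M.IsFlat L ∧ M.eRk L + 2 = M.eRank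

/-- The copoint partition of a coline `L`: its classes are the sets `H \ L`, for the copoints `H`
that contain `L`. -/
def copointPartition {α : Type u} (M : Matroid α) (L : Set α) : Set (Set α) :=
  {Q | ∃ H, M.IsCopoint H ∧ L ⊆ H ∧ Q = H \ L}

/-- There are more singular classes (those with exactly one element) than multiple classes (the
others). -/
def MoreSingular {α : Type u} (P : Set (Set α)) : Prop :=
  {Q ∈ P | Q.encard ≠ 1}.encard < {Q ∈ P | Q.encard = 1}.encard

/-- The matroid has a positive coline. -/
def HasPositiveColine {α : Type u} (M : Matroid α) : Prop :=
  ∃ L, M.IsColine L ∧ MoreSingular (M.copointPartition L)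

/-! ### Double circuits -/

/-- A double circuit is a set `D` of elements with `r(D) = |D| - 2` and `r(D - d) = r(D)` for every
`d ∈ D`. -/
def IsDoubleCircuit {α : Type u} (M : Matroid α) (D : Set α) : Prop :=
  D ⊆ M.E ∧ M.eRk D + 2 = D.encard ∧ ∀ d ∈ D, M.eRk (D \ {d}) = M.eRk D

/-- The circuit partition of a double circuit `D`: its classes are the sets `D \ C`, for the
circuits `C` contained in `D`; so the circuits contained in `D` are the sets `D \ Q`, for the
classes `Q`. -/
def circuitPartition {α : Type u} (M : Matroid α) (D : Set α) : Set (Set α) :=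
  {Q | ∃ C, M.IsCircuit C ∧ C ⊆ D ∧ Q = D \ C}

/-- The matroid has a positive double circuit. -/
def HasPositiveDoubleCircuit {α : Type u} (M : Matroid α) : Prop :=
  ∃ D, M.IsDoubleCircuit D ∧ MoreSingular (M.circuitPartition D)

/-- A cosimple gammoid of corank at least two without positive double circuits. -/
def IsDoubleCircuitCounterexample {α : Type u} (M : Matroid α) : Prop :=
  M.IsGammoid ∧ M.IsCosimple ∧ 2 ≤ M.corank ∧ ¬ M.HasPositiveDoubleCircuit

/-- A simple gammoid of rank at least two without positive colines. -/
def IsColineCounterexample {α : Type u} (M : Matroid α) : Prop :=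
  M.IsGammoid ∧ M.IsSimple ∧ 2 ≤ M.eRank ∧ ¬ M.HasPositiveColine

/-! ### Bicircular matroids -/

/-- `M` is the bicircular matroid `B(G)`: its elements are the edges of `G`, and a set `I` of edges
is independent if and only if every connected component of the graph with edge set `I` contains at
most one cycle. A cycle, as a subgraph, is identified by its edge set. (Only graphs without loops
and parallel edges are needed here, as these are cycles of length one and two.) -/
def IsBicircularMatroidOf {V : Type u} (M : Matroid (Sym2 V)) (G : SimpleGraph V) : Prop :=
  M.E = G.edgeSet ∧
  ∀ I ⊆ G.edgeSet, (M.Indep I ↔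
    ∀ (u v : V) (c : (SimpleGraph.fromEdgeSet I).Walk u u)
      (d : (SimpleGraph.fromEdgeSet I).Walk v v),
      c.IsCycle → d.IsCycle → (SimpleGraph.fromEdgeSet I).Reachable u v →
        {e | e ∈ c.edges} = {e | e ∈ d.edges})

/-- A graph has at most one bicircular matroid. -/
theorem IsBicircularMatroidOf.unique {V : Type u} {M N : Matroid (Sym2 V)} {G : SimpleGraph V}
    (hM : M.IsBicircularMatroidOf G) (hN : N.IsBicircularMatroidOf G) : M = N := by
  refine Matroid.ext_indep (hM.1.trans hN.1.symm) fun I hI => ?_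
  rw [hM.1] at hI
  rw [hM.2 I hI, hN.2 I hI]

end Matroid

/-- The Petersen graph: the vertices are the two-element subsets of a five-element set, and two of
them are adjacent if and only if they are disjoint. -/
def petersenGraph : SimpleGraph {s : Finset (Fin 5) // s.card = 2} where
  Adj s t := Disjoint s.1 t.1
  symm := ⟨fun _ _ h => h.symm⟩
  loopless := ⟨fun s h => by
    have h0 : s.1 = ∅ := disjoint_self.mp h
    have h2 := s.2
    rw [h0] at h2
    simp at h2⟩

open Set

/-! ### Transversal matroids -/

section Transversal

variable {α β : Type*}

/-- The set of all elements related to some element of `J`. -/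
def nbhd (r : α → β → Prop) (J : Set α) : Set β := {b | ∃ a ∈ J, r a b}

/-- Hall's condition for the set `I`. -/
def HallOn (r : α → β → Prop) (I : Set α) : Prop :=
  ∀ J ⊆ I, J.ncard ≤ (nbhd r J).ncard

variable {r : α → β → Prop} {I J : Set α}

theorem nbhd_mono (h : I ⊆ J) : nbhd r I ⊆ nbhd r J :=
  fun _ ⟨a, ha, hb⟩ => ⟨a, h ha, hb⟩

theorem nbhd_union : nbhd r (I ∪ J) = nbhd r I ∪ nbhd r J := by
  ext b
  simp only [nbhd, mem_union, mem_ofPred_eq]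
  constructor
  · rintro ⟨a, h | h, hb⟩
    exacts [Or.inl ⟨a, h, hb⟩, Or.inr ⟨a, h, hb⟩]
  · rintro (⟨a, h, hb⟩ | ⟨a, h, hb⟩)
    exacts [⟨a, Or.inl h, hb⟩, ⟨a, Or.inr h, hb⟩]

theorem HallOn.subset (hJ : HallOn r J) (h : I ⊆ J) : HallOn r I :=
  fun K hK => hJ K (hK.trans h)

theorem hallOn_iff_exists_injective [Finite α] [Finite β] :
    HallOn r I ↔ ∃ f : I → β, Function.Injective f ∧ ∀ a : I, r a (f a) := by
  classical
  have := Fintype.ofFinite α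
  have := Fintype.ofFinite β
  rw [← Fintype.all_card_le_filter_rel_iff_exists_injective (fun (a : I) b => r a b)]
  constructor
  · intro h A
    have h1 := h (Subtype.val '' (A : Set I)) (by rintro _ ⟨a, _, rfl⟩; exact a.2)
    rw [ncard_image_of_injective _ Subtype.val_injective, ncard_coe_finset] at h1
    refine h1.trans_eq ?_
    rw [← ncard_coe_finset]
    congr 1
    ext b
    simp [nbhd]
  · intro h J hJ
    have h1 := h (Finset.univ.filter fun a : I => (a : α) ∈ J)
    rw [← ncard_coe_finset, ← ncard_coe_finset] at h1
    refine le_trans (le_of_eq ?_) (h1.trans_eq ?_)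
    · rw [← ncard_image_of_injective _ Subtype.val_injective]
      congr 1
      ext a
      simp only [Finset.coe_filter, Finset.mem_univ, true_and, mem_image, mem_ofPred_eq,
        Subtype.exists, exists_and_left, exists_prop, exists_eq_right_right]
      exact ⟨fun ha => ⟨ha, hJ ha⟩, fun ha => ha.1⟩
    · congr 1
      ext b
      simp only [nbhd, Finset.coe_filter, Finset.mem_univ, true_and, Finset.mem_filter,
        mem_ofPred_eq, Subtype.exists, exists_and_left, exists_prop]
      exact ⟨fun ⟨a, h1, _, h2⟩ => ⟨a, h1, h2⟩, fun ⟨a, h1, h2⟩ => ⟨a, h1, hJ h1, h2⟩⟩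

theorem HallOn.augment [Finite α] [Finite β] (hI : HallOn r I) (hJ : HallOn r J)
    (hlt : I.ncard < J.ncard) : ∃ e ∈ J, e ∉ I ∧ HallOn r (insert e I) := by
  by_contra! hcon
  -- a maximal tight subset `X` of `I`
  obtain ⟨X, -, hX⟩ := (Set.toFinite {X | X ⊆ I ∧ (nbhd r X).ncard = X.ncard}).exists_le_maximal
    (show (∅ : Set α) ∈ _ from ⟨empty_subset _, by simp [nbhd]⟩)
  obtain ⟨⟨hXI, hXt⟩, hXmax⟩ := hX
  have htight : ∀ Y ⊆ I, (nbhd r Y).ncard = Y.ncard → Y ⊆ X := by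
    intro Y hY hYt
    refine subset_union_right.trans (hXmax ⟨union_subset hXI hY, ?_⟩ subset_union_left)
    have h1 := ncard_union_add_ncard_inter (nbhd r X) (nbhd r Y)
    have h2 := ncard_union_add_ncard_inter X Y
    have h3 := hI (X ∩ Y) (inter_subset_left.trans hXI)
    have h4 : (nbhd r (X ∩ Y)).ncard ≤ (nbhd r X ∩ nbhd r Y).ncard :=
      ncard_le_ncard (subset_inter (nbhd_mono inter_subset_left) (nbhd_mono inter_subset_right))
    have h5 := hI (X ∪ Y) (union_subset hXI hY)
    rw [nbhd_union] at h5 ⊢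
    omega
  have hnb : ∀ e ∈ J \ I, nbhd r {e} ⊆ nbhd r X := by
    rintro e ⟨heJ, heI⟩
    have h1 := hcon e heJ heI
    simp only [HallOn, not_forall, not_le] at h1
    obtain ⟨K, hK, hlt⟩ := h1
    have heK : e ∈ K := by
      by_contra heK
      have := hI K ((subset_insert_iff_of_notMem heK).1 hK)
      omega
    have hYI : K \ {e} ⊆ I := by
      rintro x ⟨hx, hxe⟩
      exact (hK hx).resolve_left hxe
    have h2 := hI _ hYI
    have h3 : (nbhd r (K \ {e})).ncard ≤ (nbhd r K).ncard :=
      ncard_le_ncard (nbhd_mono sdiff_subset)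
    have h4 := ncard_sdiff_singleton_add_one heK
    have h5 : nbhd r (K \ {e}) = nbhd r K :=
      eq_of_subset_of_ncard_le (nbhd_mono sdiff_subset) (by omega)
    calc nbhd r {e} ⊆ nbhd r K := nbhd_mono (by simpa using heK)
      _ = nbhd r (K \ {e}) := h5.symm
      _ ⊆ nbhd r X := nbhd_mono (htight _ hYI (by omega))
  have hN : nbhd r ((J ∩ X) ∪ (J \ I)) ⊆ nbhd r X := by
    rintro b ⟨a, ha | ha, hb⟩
    · exact ⟨a, ha.2, hb⟩
    · exact hnb a ha ⟨a, rfl, hb⟩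
  have h1 := hJ ((J ∩ X) ∪ (J \ I)) (union_subset inter_subset_left sdiff_subset)
  have h2 := ncard_le_ncard hN
  have h3 : J ⊆ ((J ∩ X) ∪ (J \ I)) ∪ (I \ X) := by
    intro x hx
    by_cases hxI : x ∈ I <;> by_cases hxX : x ∈ X <;> simp [hx, hxI, hxX]
  have h4 := (ncard_le_ncard h3).trans (ncard_union_le _ _)
  have h5 := ncard_sdiff_add_ncard_of_subset hXI
  omega

/-- The transversal matroid on `E` of a relation between finite types. -/
def transversalMatroid [Finite α] [Finite β] (r : α → β → Prop) (E : Set α) : Matroid α :=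
  (IndepMatroid.ofFinite (toFinite E) (fun I => I ⊆ E ∧ HallOn r I)
    ⟨empty_subset _, fun J hJ => by simp [subset_empty_iff.1 hJ]⟩
    (fun _ _ hJ h => ⟨h.trans hJ.1, hJ.2.subset h⟩)
    (fun I J hI hJ hlt => by
      obtain ⟨e, heJ, heI, h⟩ := hI.2.augment hJ.2 hlt
      exact ⟨e, heJ, heI, insert_subset (hJ.1 heJ) hI.1, h⟩)
    (fun _ hI => hI.1)).matroid

end Transversal

/-! ### Linkings and matchings -/

section Linking

variable {V : Type u}

/-- In a list without duplicates, an element has at most one predecessor. -/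
theorem List.Nodup.pred_unique {l a b c d : List V} {x y z : V} (hl : l.Nodup)
    (h1 : l = a ++ x :: z :: b) (h2 : l = c ++ y :: z :: d) : x = y := by
  have h3 : (a ++ [x]) ++ z :: b = (c ++ [y]) ++ z :: d := by
    simpa using h1.symm.trans h2
  have h4 : ((a ++ [x]) ++ z :: b).Nodup := by simpa [h1] using hl
  have e1 : z ∉ a ++ [x] := fun h => by
    rw [List.nodup_append] at h4
    exact h4.2.2 z h z (by simp) rfl
  have e2 : z ∉ b := fun h => by
    rw [List.nodup_append, List.nodup_cons] at h4
    exact h4.2.1.1 h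
  have h6 := (List.append_cons_inj_of_notMem e1 e2).1 h3
  have h7 := h6.1
  simpa using congrArg List.getLast? h7

theorem exists_matching_of_isLinkedInto {D : Digraph V} {X T : Set V}
    (h : Matroid.IsLinkedInto D X T) :
    ∃ g : ↥Tᶜ → V, Function.Injective g ∧ (∀ w, g w = w ∨ D.Adj w (g w)) ∧ ∀ w, g w ∉ X := by
  classical
  obtain ⟨p, hp, hdisj⟩ := h
  have hx_unique : ∀ x ∈ X, ∀ y ∈ X, ∀ v, v ∈ x :: p x → v ∈ y :: p y → x = y := by
    intro x hx y hy v h1 h2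
    by_contra hne
    exact hdisj x hx y hy hne h1 h2
  let N : V → V → Prop := fun w v => ∃ x ∈ X, ∃ a b, x :: p x = a ++ w :: v :: b
  have hN_inj : ∀ w w' v, N w v → N w' v → w = w' := by
    rintro w w' v ⟨x, hx, a, b, h⟩ ⟨y, hy, c, d, h'⟩
    obtain rfl := hx_unique x hx y hy v (by rw [h]; simp) (by rw [h']; simp)
    exact (hp x hx).1.pred_unique h h'
  have hN_ex : ∀ w : ↥Tᶜ, (∃ x ∈ X, (w : V) ∈ x :: p x) → ∃ v, N w v := by
    rintro ⟨w, hw⟩ ⟨x, hx, hwx⟩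
    obtain ⟨a, b, h⟩ := List.append_of_mem hwx
    cases b with
    | nil =>
      refine absurd ?_ hw
      have := (hp x hx).2.2
      simp only [h, List.getLast_append_singleton] at this
      exact this
    | cons v b => exact ⟨v, x, hx, a, b, h⟩
  have hN_X : ∀ w v, N w v → v ∉ X := by
    rintro w v ⟨x, hx, a, b, h⟩ hv
    obtain rfl := hx_unique x hx v hv v (by rw [h]; simp) (by simp)
    have hnd := (hp x hx).1
    cases a with
    | nil =>
      simp only [List.nil_append, List.cons.injEq] at h
      rw [h.2, List.nodup_cons] at hnd
      exact hnd.1 (by simp)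
    | cons c a =>
      simp only [List.cons_append, List.cons.injEq] at h
      rw [h.2, List.nodup_cons] at hnd
      exact hnd.1 (by simp)
  have key : ∀ w : ↥Tᶜ, ∃ v, N w v ∨ ((¬ ∃ x ∈ X, (w : V) ∈ x :: p x) ∧ v = w) := by
    intro w
    by_cases h : ∃ x ∈ X, (w : V) ∈ x :: p x
    · obtain ⟨v, hv⟩ := hN_ex w h
      exact ⟨v, Or.inl hv⟩
    · exact ⟨w, Or.inr ⟨h, rfl⟩⟩
  have hN_mem : ∀ w v, N w v → ∃ x ∈ X, v ∈ x :: p x := by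
    rintro w v ⟨x, hx, a, b, h⟩
    exact ⟨x, hx, by rw [h]; simp⟩
  choose g hg using key
  refine ⟨g, ?_, ?_, ?_⟩
  · intro w w' hww
    rcases hg w with h | ⟨h, e⟩ <;> rcases hg w' with h' | ⟨h', e'⟩
    · exact Subtype.ext (hN_inj _ _ _ h (hww ▸ h'))
    · exact absurd (hN_mem _ _ h) (by rwa [hww, e'])
    · exact absurd (hN_mem _ _ h') (by rwa [← hww, e])
    · exact Subtype.ext (e.symm.trans (hww.trans e'))
  · intro w
    rcases hg w with ⟨x, hx, a, b, h⟩ | ⟨_, e⟩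
    · right
      have := (hp x hx).2.1
      rw [h, List.isChain_append] at this
      exact this.2.1.rel
    · exact Or.inl e
  · intro w hw
    rcases hg w with h | ⟨h, e⟩
    · exact hN_X _ _ h hw
    · exact h ⟨g w, hw, by rw [← e]; simp⟩

theorem isLinkedInto_of_matching [Finite V] {D : Digraph V} {X T : Set V} {g : ↥Tᶜ → V}
    (hg : Function.Injective g) (hD : ∀ w, g w = w ∨ D.Adj w (g w)) (hX : ∀ w, g w ∉ X) :
    Matroid.IsLinkedInto D X T := by
  classical
  let s : V → V := fun v => if h : v ∈ T then v else g ⟨v, h⟩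
  have hs_inj : ∀ v w, v ∉ T → w ∉ T → s v = s w → v = w := by
    intro v w hv hw h
    simp only [s, hv, hw, dif_neg, not_false_eq_true] at h
    simpa using hg h
  have hs_X : ∀ v, v ∉ T → s v ∉ X := by
    intro v hv
    simp only [s, hv, dif_neg, not_false_eq_true]
    exact hX _
  have hs_D : ∀ v, v ∉ T → s v = v ∨ D.Adj v (s v) := by
    intro v hv
    simp only [s, hv, dif_neg, not_false_eq_true]
    exact hD ⟨v, hv⟩
  -- iterating `s` from two elements of `X`, before reaching `T`, never leads to the same vertex
  have hiter : ∀ i j x y, x ∈ X → y ∈ X → (∀ k < i, s^[k] x ∉ T) → (∀ k < j, s^[k] y ∉ T) →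
      s^[i] x = s^[j] y → i = j ∧ x = y := by
    intro i
    induction i with
    | zero =>
      intro j x y hx hy _ hj h
      cases j with
      | zero => exact ⟨rfl, h⟩
      | succ j =>
        rw [Function.iterate_succ_apply'] at h
        exact absurd (h ▸ hx : s (s^[j] y) ∈ X) (hs_X _ (hj j (by omega)))
    | succ i ih =>
      intro j x y hx hy hi hj h
      cases j with
      | zero =>
        rw [Function.iterate_succ_apply'] at h
        exact absurd (h ▸ hy : s (s^[i] x) ∈ X) (hs_X _ (hi i (by omega)))
      | succ j =>
        rw [Function.iterate_succ_apply', Function.iterate_succ_apply'] at h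
        have := ih j x y hx hy (fun k hk => hi k (by omega)) (fun k hk => hj k (by omega))
          (hs_inj _ _ (hi i (by omega)) (hj j (by omega)) h)
        exact ⟨by rw [this.1], this.2⟩
  have hreach : ∀ x ∈ X, ∃ n, s^[n] x ∈ T := by
    intro x hx
    by_contra! hcon
    refine not_injective_infinite_finite (fun n => s^[n] x) fun i j h => ?_
    exact (hiter i j x x hx hx (fun k _ => hcon k) (fun k _ => hcon k) h).1
  let n : V → ℕ := fun x => if h : ∃ n, s^[n] x ∈ T then Nat.find h else 0
  have hnT : ∀ x ∈ X, s^[n x] x ∈ T := by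
    intro x hx
    simp only [n, hreach x hx, dif_pos]
    exact Nat.find_spec (hreach x hx)
  have hnlt : ∀ x ∈ X, ∀ k < n x, s^[k] x ∉ T := by
    intro x hx k hk
    simp only [n, hreach x hx, dif_pos] at hk
    exact Nat.find_min (hreach x hx) hk
  have hlist : ∀ x, x :: ((List.range (n x)).map fun i => s^[i + 1] x) =
      (List.range (n x + 1)).map fun i => s^[i] x := by
    intro x
    rw [List.range_succ_eq_map, List.map_cons, List.map_map]
    rfl
  refine ⟨fun x => (List.range (n x)).map fun i => s^[i + 1] x, ?_, ?_⟩
  · intro x hx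
    refine ⟨?_, ?_, ?_⟩
    · rw [hlist]
      refine List.Nodup.map_on ?_ List.nodup_range
      intro i hi j hj h
      rw [List.mem_range] at hi hj
      exact (hiter i j x x hx hx (fun k hk => hnlt x hx k (by omega))
        (fun k hk => hnlt x hx k (by omega)) h).1
    · rw [hlist, List.isChain_iff_getElem]
      intro i hi
      simp only [List.length_map, List.length_range] at hi
      simp only [List.getElem_map, List.getElem_range]
      have hiT := hnlt x hx i (by omega)
      rw [Function.iterate_succ_apply']
      refine (hs_D _ hiT).resolve_left fun h => ?_
      have := (hiter (i + 1) i x x hx hx (fun k hk => hnlt x hx k (by omega))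
        (fun k hk => hnlt x hx k (by omega)) (by rw [Function.iterate_succ_apply', h])).1
      omega
    · have : ∀ (l : List V) (h : l ≠ []), l = (List.range (n x + 1)).map (fun i => s^[i] x) →
          l.getLast h ∈ T := by
        rintro l h rfl
        simp only [List.getLast_eq_getElem, List.getElem_map, List.getElem_range, List.length_map,
          List.length_range, Nat.add_sub_cancel]
        exact hnT x hx
      exact this _ _ (hlist x)
  · intro x hx y hy hne v hv hv'
    rw [hlist] at hv hv'
    simp only [List.mem_map, List.mem_range] at hv hv'
    obtain ⟨i, hi, rfl⟩ := hv
    obtain ⟨j, hj, h⟩ := hv'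
    exact hne (hiter i j x y hx hy (fun k hk => hnlt x hx k (by omega))
      (fun k hk => hnlt y hy k (by omega)) h.symm).2

theorem isLinkedInto_iff_exists_matching [Finite V] {D : Digraph V} {X T : Set V} :
    Matroid.IsLinkedInto D X T ↔
      ∃ g : ↥Tᶜ → V, Function.Injective g ∧ (∀ w, g w = w ∨ D.Adj w (g w)) ∧ ∀ w, g w ∉ X :=
  ⟨exists_matching_of_isLinkedInto, fun ⟨_, h1, h2, h3⟩ => isLinkedInto_of_matching h1 h2 h3⟩

end Linking

/-! ### Duality of gammoids -/

namespace Matroid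

/-- The independent sets of `M` are those sets `I` of elements for which the left vertices `W` of a
bipartite graph can be matched to right vertices outside of `I`. -/
def IsCopresentedBy {α W V : Type*} (M : Matroid α) (r : W → V → Prop) (f : α → V) : Prop :=
  InjOn f M.E ∧ ∀ I ⊆ M.E, (M.Indep I ↔
    ∃ g : W → V, Function.Injective g ∧ (∀ w, r w (g w)) ∧ ∀ w, g w ∉ f '' I)

variable {α : Type u} {M : Matroid α}

theorem IsGammoid.exists_isCopresentedBy (h : M.IsGammoid) :
    ∃ (W V : Type u) (_ : Finite W) (_ : Finite V) (r : W → V → Prop) (f : α → V),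
      M.IsCopresentedBy r f := by
  obtain ⟨V, hV, D, T, f, hf, h⟩ := h
  refine ⟨↥Tᶜ, V, inferInstance, hV, fun w v => v = w ∨ D.Adj w v, f, hf, fun I hI => ?_⟩
  rw [h I hI, isLinkedInto_iff_exists_matching]

theorem IsCopresentedBy.isGammoid {W V : Type u} [Finite V] {r : W → V → Prop}
    {f : α → V} (h : M.IsCopresentedBy r f) : M.IsGammoid := by
  obtain ⟨hf, h⟩ := h
  obtain ⟨g₀, hg₀, hr₀, -⟩ := (h ∅ (empty_subset _)).1 M.empty_indep
  refine ⟨V, inferInstance, ⟨fun x y => ∃ w, g₀ w = x ∧ r w y⟩, (range g₀)ᶜ, f, hf,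
    fun I hI => ?_⟩
  rw [h I hI, isLinkedInto_iff_exists_matching, compl_compl]
  let e := Equiv.ofInjective g₀ hg₀
  constructor
  · rintro ⟨g, hg, hr, hI⟩
    refine ⟨g ∘ e.symm, hg.comp e.symm.injective, fun w => Or.inr ⟨e.symm w, ?_, hr _⟩,
      fun w => hI _⟩
    exact Equiv.apply_ofInjective_symm hg₀ w
  · rintro ⟨g, hg, hr, hI⟩
    refine ⟨g ∘ e, hg.comp e.injective, fun w => ?_, fun w => hI _⟩
    rcases hr (e w) with h1 | ⟨w', h1, h2⟩
    · change r w (g (e w))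
      rw [h1]
      exact hr₀ w
    · rwa [hg₀ h1] at h2

/-- The rank may be assumed to be the number of right vertices that remain unmatched. -/
theorem IsCopresentedBy.exists_card_add_eq {W V : Type u} [Finite W] [Finite V]
    {r : W → V → Prop} {f : α → V} (h : M.IsCopresentedBy r f) {B : Set α}
    (hB : M.IsBase B) :
    ∃ (W' : Type u) (_ : Finite W') (r' : W' → V → Prop),
      M.IsCopresentedBy r' f ∧ B.ncard + Nat.card W' = Nat.card V := by
  have card_add : ∀ I ⊆ M.E, ∀ g : W → V, Function.Injective g → (∀ w, g w ∉ f '' I) →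
      Nat.card W + I.ncard + (range g ∪ f '' I)ᶜ.ncard = Nat.card V := by
    intro I hI g hg hgI
    have h1 := ncard_add_ncard_compl (range g ∪ f '' I)
    rw [ncard_union_eq, (h.1.mono hI).ncard_image, ← Nat.card_coe_set_eq (range g),
      Nat.card_range_of_injective hg] at h1
    · exact h1
    · rw [disjoint_left]
      rintro _ ⟨w, rfl⟩
      exact hgI w
  obtain ⟨gB, hgB, -, hgBB⟩ := (h.2 B hB.subset_ground).1 hB.indep
  have hcB := card_add B hB.subset_ground gB hgB hgBB
  set d := Nat.card V - B.ncard - Nat.card W with hd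
  refine ⟨W ⊕ ULift.{u} (Fin d), inferInstance,
    fun w v => Sum.elim (fun w => r w v) (fun _ => True) w,
    ⟨h.1, fun I hI => ⟨fun hind => ?_, ?_⟩⟩, ?_⟩
  · obtain ⟨B', hB', hIB'⟩ := hind.exists_isBase_superset
    obtain ⟨g, hg, hr, hgB'⟩ := (h.2 B' hB'.subset_ground).1 hB'.indep
    have hcB' := card_add B' hB'.subset_ground g hg hgB'
    have hBB' : B.ncard = B'.ncard := hB.ncard_eq_ncard_of_isBase hB'
    have hcard : Nat.card (ULift.{u} (Fin d)) = Nat.card ↥(range g ∪ f '' B')ᶜ := by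
      rw [Nat.card_coe_set_eq, Nat.card_ulift, Nat.card_fin]
      omega
    obtain ⟨e⟩ := Finite.card_eq.1 hcard
    have he : ∀ i, (e i : V) ∉ range g ∪ f '' B' := fun i => (e i).2
    refine ⟨Sum.elim g fun i => e i, ?_, ?_, ?_⟩
    · refine hg.sumElim (Subtype.val_injective.comp e.injective) fun w i hwi => ?_
      exact he i (Or.inl ⟨w, hwi⟩)
    · rintro (w | i)
      exacts [hr w, trivial]
    · rintro (w | i) hw
      exacts [hgB' w (image_mono hIB' hw), he i (Or.inr (image_mono hIB' hw))]
  · rintro ⟨g, hg, hr, hgI⟩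
    exact (h.2 I hI).2 ⟨g ∘ Sum.inl, hg.comp Sum.inl_injective, fun w => hr (Sum.inl w),
      fun w => hgI _⟩
  · rw [Nat.card_sum, Nat.card_ulift, Nat.card_fin]
    omega

/-- A co-presentation of the dual. -/
theorem IsCopresentedBy.dual {W V : Type u} [Finite W] [Finite V]
    {r : W → V → Prop} {f : α → V} (h : M.IsCopresentedBy r f) (hfin : M.E.Finite)
    (hn : ∀ B, M.IsBase B → B.ncard + Nat.card W = Nat.card V) :
    M✶.IsCopresentedBy
      (fun (v : V) (x : W ⊕ V) => Sum.elim (fun w => r w v) (fun v' => v' = v ∧ v ∈ f '' M.E) x)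
      (fun a => Sum.inr (f a)) := by
  classical
  obtain ⟨hf, h⟩ := h
  refine ⟨fun a ha b hb hab => hf ha hb (Sum.inr_injective hab), fun Y hY => ?_⟩
  rw [dual_ground] at hY
  rw [dual_indep_iff_exists hY]
  constructor
  · rintro ⟨B, hB, hYB⟩
    obtain ⟨g, hg, hr, hgB⟩ := (h B hB.subset_ground).1 hB.indep
    have hrange : range g = (f '' B)ᶜ := by
      refine eq_of_subset_of_ncard_le ?_ ?_
      · rintro _ ⟨w, rfl⟩
        exact hgB w
      · have h1 := ncard_add_ncard_compl (f '' B)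
        rw [(hf.mono hB.subset_ground).ncard_image] at h1
        rw [← Nat.card_coe_set_eq (range g), Nat.card_range_of_injective hg]
        have := hn B hB
        omega
    have hinv : ∀ v, v ∉ f '' B → ∃ w, g w = v := fun v hv => by
      have : v ∈ range g := hrange ▸ hv
      exact this
    choose k hk using hinv
    refine ⟨fun v => if hv : v ∈ f '' B then Sum.inr v else Sum.inl (k v hv), ?_, ?_, ?_⟩
    · intro v v' hvv
      by_cases hv : v ∈ f '' B <;> by_cases hv' : v' ∈ f '' B <;>
        simp only [hv, hv', dite_true, dite_false, Sum.inr.injEq, Sum.inl.injEq, reduceCtorEq] at hvv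
      · exact hvv
      · rw [← hk v hv, ← hk v' hv', hvv]
    · intro v
      by_cases hv : v ∈ f '' B
      · simp only [hv, dite_true, Sum.elim_inr, true_and]
        exact image_mono hB.subset_ground hv
      · simp only [hv, dite_false, Sum.elim_inl]
        have := hr (k v hv)
        rwa [hk v hv] at this
    · rintro v ⟨y, hy, hyv⟩
      by_cases hv : v ∈ f '' B
      · simp only [hv, dite_true, Sum.inr.injEq] at hyv
        obtain ⟨b, hb, rfl⟩ := hv
        obtain rfl := hf (hY hy) (hB.subset_ground hb) hyv
        exact disjoint_left.1 hYB hy hb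
      · simp [hv] at hyv
  · rintro ⟨g, hg, hr, hgY⟩
    let N := transversalMatroid (fun v w => r w v) (univ : Set V)
    let A : Set V := {v | ∃ w, g v = Sum.inl w}
    have hAc : ∀ v, v ∉ A → v ∈ f '' M.E ∧ v ∉ f '' Y := by
      intro v hv
      rcases hgv : g v with w | v'
      · exact absurd ⟨w, hgv⟩ hv
      · have h1 := hr v
        have h2 := hgY v
        rw [hgv] at h1 h2
        obtain ⟨rfl, h3⟩ := h1
        refine ⟨h3, ?_⟩
        rintro ⟨y, hy, rfl⟩
        exact h2 ⟨y, hy, rfl⟩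
    have hA : N.Indep A := by
      refine ⟨subset_univ _, hallOn_iff_exists_injective.2 ?_⟩
      choose k hk using fun v : A => v.2
      refine ⟨k, fun v v' hvv => ?_, fun v => ?_⟩
      · exact Subtype.ext (hg (by rw [hk v, hk v', hvv]))
      · have := hr v
        rwa [hk v] at this
    obtain ⟨g₀, hg₀, hr₀, -⟩ := (h ∅ (empty_subset _)).1 M.empty_indep
    have hR : N.Indep (range g₀) := by
      refine ⟨subset_univ _, hallOn_iff_exists_injective.2
        ⟨(Equiv.ofInjective g₀ hg₀).symm, (Equiv.ofInjective g₀ hg₀).symm.injective, fun v => ?_⟩⟩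
      have := hr₀ ((Equiv.ofInjective g₀ hg₀).symm v)
      rwa [Equiv.apply_ofInjective_symm hg₀ v] at this
    obtain ⟨A', hA', hAA'⟩ := hA.exists_isBase_superset
    obtain ⟨R', hR', hRR'⟩ := hR.exists_isBase_superset
    have hcard : Nat.card W ≤ A'.ncard := by
      rw [hA'.ncard_eq_ncard_of_isBase hR', ← Nat.card_range_of_injective hg₀,
        Nat.card_coe_set_eq]
      exact ncard_le_ncard hRR'
    obtain ⟨k, hk, hkr⟩ := hallOn_iff_exists_injective.1 hA'.indep.2
    have hkb : Function.Bijective k := by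
      refine (Nat.bijective_iff_injective_and_card k).2 ⟨hk, le_antisymm
        (Nat.card_le_card_of_injective k hk) ?_⟩
      rwa [Nat.card_coe_set_eq]
    let e := Equiv.ofBijective k hkb
    have hind : M.Indep {a ∈ M.E | f a ∉ A'} := by
      refine (h _ (sep_subset _ _)).2 ⟨fun w => e.symm w,
        Subtype.val_injective.comp e.symm.injective, fun w => ?_, ?_⟩
      · have := hkr (e.symm w)
        rwa [show k (e.symm w) = w from e.apply_symm_apply w] at this
      · rintro w ⟨a, ⟨-, ha⟩, haw⟩
        exact ha (haw ▸ (e.symm w).2)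
    have hIc : f '' {a ∈ M.E | f a ∉ A'} = A'ᶜ := by
      ext v
      constructor
      · rintro ⟨a, ⟨-, ha⟩, rfl⟩
        exact ha
      · intro hv
        obtain ⟨⟨a, ha, rfl⟩, -⟩ := hAc v fun hvA => hv (hAA' hvA)
        exact ⟨a, ⟨ha, hv⟩, rfl⟩
    obtain ⟨B, hB, hIB⟩ := hind.exists_isBase_superset
    have hIB' : {a ∈ M.E | f a ∉ A'} = B := by
      refine eq_of_subset_of_ncard_le hIB ?_ (hfin.subset hB.subset_ground)
      have h1 := ncard_add_ncard_compl A'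
      rw [← hIc, (hf.mono (sep_subset _ _)).ncard_image] at h1
      have h2 := hn B hB
      have h3 : A'.ncard ≤ Nat.card W := by
        rw [← Nat.card_coe_set_eq]
        exact Nat.card_le_card_of_injective k hk
      omega
    refine ⟨B, hB, disjoint_left.2 fun y hy hyB => ?_⟩
    rw [← hIB'] at hyB
    by_cases hyA : f y ∈ A
    · exact hyB.2 (hAA' hyA)
    · exact (hAc _ hyA).2 ⟨y, hy, rfl⟩

theorem IsGammoid.dual (h : M.IsGammoid) : M✶.IsGammoid := by
  have hfin : M.E.Finite := by
    obtain ⟨V, hV, -, -, f, hf, -⟩ := h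
    exact Finite.of_finite_image (toFinite (f '' M.E)) hf
  obtain ⟨W, V, hW, hV, r, f, h⟩ := h.exists_isCopresentedBy
  obtain ⟨B, hB⟩ := M.exists_isBase
  obtain ⟨W', hW', r', h', hcard⟩ := h.exists_card_add_eq hB
  exact (h'.dual hfin fun B' hB' => by rwa [hB'.ncard_eq_ncard_of_isBase hB]).isGammoid

theorem isGammoid_dual_iff : M✶.IsGammoid ↔ M.IsGammoid :=
  ⟨fun h => by simpa using h.dual, IsGammoid.dual⟩

/-! ### Duality of double circuits and colines -/

theorem isFlat_dual_compl_iff [M.Finite] {C : Set α} (hC : C ⊆ M.E) (k : ℕ) :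
    (M✶.IsFlat (M.E \ C) ∧ M✶.eRk (M.E \ C) + k = M✶.eRank) ↔
      (M.eRk C + k = C.encard ∧ ∀ d ∈ C, M.eRk (C \ {d}) = M.eRk C) := by
  have hfin := M.ground_finite
  have hdual : ∀ X ⊆ M.E, M✶.eRk (M.E \ X) + M.eRank = M.eRk X + (M.E \ X).encard := by
    intro X hX
    have := M.eRk_dual_add_eRank (M.E \ X) sdiff_subset
    rwa [sdiff_sdiff_cancel_left hX] at this
  have hnat : ∀ (N : Matroid α), N.E = M.E → ∀ X, ∃ n : ℕ, N.eRk X = n := by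
    intro N hN X
    have : N.eRk X ≤ M.E.encard := (N.eRk_le_eRank X).trans (hN ▸ N.eRank_le_encard_ground)
    exact ENat.ne_top_iff_exists.1 (ne_top_of_le_ne_top hfin.encard_lt_top.ne this) |>.imp
      fun _ h => h.symm
  have hadd := M.eRank_add_eRank_dual
  have hE : M.E.encard = C.encard + (M.E \ C).encard := by
    rw [add_comm, encard_sdiff_add_encard_of_subset hC]
  have hCd := hdual C hC
  obtain ⟨r, hr⟩ := hnat M rfl M.E
  obtain ⟨r', hr'⟩ := hnat M✶ rfl M.E
  rw [eRk_ground] at hr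
  have hr'' : M✶.eRank = r' := by rw [← hr', ← M✶.eRk_ground, dual_ground]
  obtain ⟨c, hc⟩ := hnat M rfl C
  obtain ⟨c', hc'⟩ := hnat M✶ rfl (M.E \ C)
  have hcn := (hfin.subset hC).cast_ncard_eq
  have hcn' := (hfin.subset (sdiff_subset (s := M.E) (t := C))).cast_ncard_eq
  rw [hE, hr, hr'', ← hcn, ← hcn'] at hadd
  rw [hc', hr, hc, ← hcn'] at hCd
  have hrank : M✶.eRk (M.E \ C) + k = M✶.eRank ↔ M.eRk C + k = C.encard := by
    rw [hc', hr'', hc, ← hcn]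
    norm_cast at hadd hCd ⊢
    omega
  rw [hrank, and_comm]
  refine and_congr_right fun _ => ?_
  have hins : ∀ d ∈ C, insert d (M.E \ C) = M.E \ (C \ {d}) := by
    intro d hd
    ext x
    by_cases hx : x = d
    · subst hx; simp [hC hd]
    · simp [hx]
  have hstep : ∀ d ∈ C, (M.eRk (C \ {d}) = M.eRk C ↔ d ∉ M✶.closure (M.E \ C)) := by
    intro d hd
    have h1 := hdual (C \ {d}) (sdiff_subset.trans hC)
    rw [← hins d hd, encard_insert_of_notMem (by simp [hd])] at h1
    obtain ⟨x, hx⟩ := hnat M rfl (C \ {d})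
    obtain ⟨x', hx'⟩ := hnat M✶ rfl (insert d (M.E \ C))
    rw [hx, hx', hr, ← hcn'] at h1
    constructor
    · intro h2 h3
      have h4 := M✶.eRk_insert_closure_eq d (M.E \ C)
      rw [insert_eq_of_mem h3, eRk_closure_eq, hc', hx'] at h4
      rw [hx, hc] at h2
      norm_cast at *
      omega
    · intro h2
      have h3 := M✶.eRk_insert_eq_add_one (X := M.E \ C) ⟨hC hd, h2⟩
      rw [hx', hc'] at h3
      rw [hx, hc]
      norm_cast at *
      omega
  constructor
  · intro hF d hd
    rw [hstep d hd, hF.closure]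
    simp [hd]
  · intro h
    rw [isFlat_iff_closure_eq]
    refine subset_antisymm (fun x hx => ?_) (M✶.subset_closure _ sdiff_subset)
    refine ⟨M✶.closure_subset_ground _ hx, fun hxC => ?_⟩
    exact (hstep x hxC).1 (h x hxC) hx

theorem isCircuit_iff_eRk [M.Finite] {C : Set α} (hC : C ⊆ M.E) :
    M.IsCircuit C ↔ M.eRk C + 1 = C.encard ∧ ∀ d ∈ C, M.eRk (C \ {d}) = M.eRk C := by
  have hfin := M.ground_finite.subset hC
  constructor
  · refine fun h => ⟨h.eRk_add_one_eq, fun d hd => ?_⟩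
    rw [(h.sdiff_singleton_isBasis hd).eRk_eq_eRk]
  · rintro ⟨h1, h2⟩
    rw [isCircuit_iff_dep_forall_sdiff_singleton_indep]
    have hne : M.eRk C ≠ ⊤ := ne_top_of_le_ne_top hfin.encard_lt_top.ne (M.eRk_le_encard C)
    refine ⟨(eRk_lt_encard_iff_dep hC).1 ?_, fun d hd => ?_⟩
    · rw [← h1]
      exact ENat.lt_add_one_iff hne |>.2 le_rfl
    · rw [indep_iff_eRk_eq_encard, h2 d hd]
      refine ENat.add_left_injective_of_ne_top ENat.one_ne_top ?_
      change M.eRk C + 1 = (C \ {d}).encard + 1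
      rw [h1, encard_sdiff_singleton_add_one hd]

theorem isCopoint_dual_compl_iff [M.Finite] {C : Set α} (hC : C ⊆ M.E) :
    M✶.IsCopoint (M.E \ C) ↔ M.IsCircuit C := by
  rw [isCircuit_iff_eRk hC, IsCopoint]
  exact_mod_cast isFlat_dual_compl_iff hC 1

theorem isColine_dual_compl_iff [M.Finite] {D : Set α} (hD : D ⊆ M.E) :
    M✶.IsColine (M.E \ D) ↔ M.IsDoubleCircuit D := by
  rw [IsDoubleCircuit, IsColine, and_iff_right hD]
  exact_mod_cast isFlat_dual_compl_iff hD 2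

theorem copointPartition_dual_compl [M.Finite] {D : Set α} (hD : D ⊆ M.E) :
    M✶.copointPartition (M.E \ D) = M.circuitPartition D := by
  ext Q
  constructor
  · rintro ⟨H, hH, hDH, rfl⟩
    have hHE : H ⊆ M.E := hH.1.subset_ground
    refine ⟨M.E \ H, ?_, ?_, ?_⟩
    · rw [← isCopoint_dual_compl_iff sdiff_subset, sdiff_sdiff_cancel_left hHE]
      exact hH
    · rintro x ⟨hx, hxH⟩
      by_contra hxD
      exact hxH (hDH ⟨hx, hxD⟩)
    · ext x
      have h1 := @hHE x
      have h2 := @hD x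
      simp only [mem_sdiff]
      tauto
  · rintro ⟨C, hC, hCD, rfl⟩
    refine ⟨M.E \ C, (isCopoint_dual_compl_iff hC.subset_ground).2 hC,
      sdiff_subset_sdiff_right hCD, ?_⟩
    ext x
    have h2 := @hD x
    simp only [mem_sdiff]
    tauto

theorem hasPositiveColine_dual_iff [M.Finite] :
    M✶.HasPositiveColine ↔ M.HasPositiveDoubleCircuit := by
  constructor
  · rintro ⟨L, hL, hpos⟩
    have hLE : L ⊆ M.E := hL.1.subset_ground
    rw [← sdiff_sdiff_cancel_left hLE] at hL hpos
    rw [copointPartition_dual_compl sdiff_subset] at hpos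
    exact ⟨_, (isColine_dual_compl_iff sdiff_subset).1 hL, hpos⟩
  · rintro ⟨D, hD, hpos⟩
    refine ⟨M.E \ D, (isColine_dual_compl_iff hD.1).2 hD, ?_⟩
    rwa [copointPartition_dual_compl hD.1]

theorem isDoubleCircuitCounterexample_iff_dual [M.Finite] :
    M.IsDoubleCircuitCounterexample ↔ M✶.IsColineCounterexample := by
  rw [IsDoubleCircuitCounterexample, IsColineCounterexample, isGammoid_dual_iff,
    hasPositiveColine_dual_iff]
  rfl

end Matroid

/-! ### Bicircular matroids are transversal -/

section Bicircular

variable {V : Type u}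

/-- The set of ends of the edges in `J`. -/
def edgeEnds (J : Set (Sym2 V)) : Set V := nbhd (fun e v => v ∈ e) J

theorem edgeEnds_mono {I J : Set (Sym2 V)} (h : I ⊆ J) : edgeEnds I ⊆ edgeEnds J := nbhd_mono h

theorem edgeEnds_union (I J : Set (Sym2 V)) : edgeEnds (I ∪ J) = edgeEnds I ∪ edgeEnds J :=
  nbhd_union

theorem ncard_add_one_le_of_isAcyclic [Finite V] {J : Set (Sym2 V)} (hne : J.Nonempty)
    (hd : ∀ e ∈ J, ¬ e.IsDiag) (hac : (SimpleGraph.fromEdgeSet J).IsAcyclic) :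
    J.ncard + 1 ≤ (edgeEnds J).ncard := by
  obtain ⟨⟨x, y⟩, he⟩ := hne
  have : Nonempty (edgeEnds J) := ⟨⟨x, s(x, y), he, by simp⟩⟩
  obtain ⟨T, hT, -, hTree⟩ :=
    (SimpleGraph.connected_top (V := edgeEnds J)).exists_isTree_le_of_le_of_isAcyclic le_top
      (hac.induce (edgeEnds J))
  have hcard := (SimpleGraph.isTree_iff_connected_and_card.1 hTree).2
  rw [Nat.card_coe_set_eq, Nat.card_coe_set_eq] at hcard
  rw [← hcard, add_le_add_iff_right]
  refine (ncard_le_ncard (t := Sym2.map Subtype.val '' T.edgeSet) ?_).trans (ncard_image_le)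
  intro e he
  have hed := hd e he
  induction e with
  | _ a b =>
    refine ⟨s(⟨a, s(a, b), he, by simp⟩, ⟨b, s(a, b), he, by simp⟩), hT ?_, rfl⟩
    simpa using ⟨he, by simpa using hed⟩

theorem ncard_reachable_le [Finite V] (H : SimpleGraph V) (u : V) :
    {w | H.Reachable u w}.ncard ≤ {e ∈ H.edgeSet | ∀ w ∈ e, H.Reachable u w}.ncard + 1 := by
  have h := (H.connectedComponentMk u).connected_toSimpleGraph.card_vert_le_card_edgeSet_add_one
  have hsupp : (H.connectedComponentMk u).supp = {w | H.Reachable u w} := by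
    ext w
    simp [SimpleGraph.reachable_comm]
  have h1 : Nat.card (H.connectedComponentMk u) = {w | H.Reachable u w}.ncard := by
    rw [← hsupp, ← Nat.card_coe_set_eq]
    rfl
  rw [h1] at h
  refine h.trans (add_le_add_left ?_ 1)
  rw [Nat.card_coe_set_eq, ← ncard_image_of_injective _ (Sym2.map.injective Subtype.val_injective)]
  refine ncard_le_ncard ?_
  rintro _ ⟨e, he, rfl⟩
  induction e with
  | _ a b =>
    refine ⟨he, fun w hw => ?_⟩
    have hab : ∀ c : H.connectedComponentMk u, H.Reachable u c := fun c =>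
      (SimpleGraph.ConnectedComponent.exact c.2).symm
    rw [Sym2.map_mk, Sym2.mem_iff] at hw
    rcases hw with rfl | rfl
    exacts [hab a, hab b]

theorem reachable_deleteEdges_of_mem_cycle {H : SimpleGraph V} {u a b : V} {e : Sym2 V}
    {c : H.Walk u u} (hc : c.IsCycle) (he : e ∈ c.edges) (hab : H.Reachable a b) :
    (H.deleteEdges {e}).Reachable a b := by
  obtain ⟨p⟩ := hab
  induction p with
  | nil => rfl
  | @cons x y z hxy p ih =>
    refine SimpleGraph.Reachable.trans ?_ ih
    by_cases hxe : s(x, y) = e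
    · subst hxe
      exact (SimpleGraph.adj_and_reachable_delete_edges_iff_exists_cycle.2 ⟨u, c, hc, he⟩).2
    · exact SimpleGraph.Adj.reachable (by simp [hxy, hxe])

theorem HallOn.mem_edges_of_isCycle [Finite V] {I : Set (Sym2 V)}
    (hI : HallOn (fun e v => v ∈ e) I) {H : SimpleGraph V} (hH : H.edgeSet ⊆ I) {u v : V}
    {c : H.Walk u u} {d : H.Walk v v} (hc : c.IsCycle) (hd : d.IsCycle)
    (huv : H.Reachable u v) {e : Sym2 V} (he : e ∈ c.edges) : e ∈ d.edges := by
  classical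
  by_contra hed
  have hsub : ∀ f ∈ d.edges, f ∈ (H.deleteEdges {e}).edgeSet := by
    intro f hf
    rw [SimpleGraph.edgeSet_deleteEdges]
    exact ⟨d.edges_subset_edgeSet hf, fun h => hed (h ▸ hf)⟩
  have hd1 := hd.transfer hsub
  obtain ⟨f, hf⟩ := List.exists_mem_of_ne_nil d.edges (by
    rw [ne_eq, SimpleGraph.Walk.edges_eq_nil]
    exact hd.not_nil)
  have hf1 : f ∈ (d.transfer _ hsub).edges := by rwa [SimpleGraph.Walk.edges_transfer]
  have hreach : ∀ {a b}, H.Reachable a b →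
      ((H.deleteEdges {e}).deleteEdges {f}).Reachable a b := fun h =>
    reachable_deleteEdges_of_mem_cycle hd1 hf1 (reachable_deleteEdges_of_mem_cycle hc he h)
  set H2 := (H.deleteEdges {e}).deleteEdges {f} with hH2
  have hH2le : H2 ≤ H := (SimpleGraph.deleteEdges_le _).trans (SimpleGraph.deleteEdges_le _)
  have hiff : ∀ a b, H2.Reachable a b ↔ H.Reachable a b :=
    fun a b => ⟨fun h => h.mono hH2le, hreach⟩
  set J : Set (Sym2 V) := {x ∈ H.edgeSet | ∀ w ∈ x, H.Reachable u w}
  have hcount := ncard_reachable_le H2 u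
  simp only [hiff] at hcount
  have hmem : ∀ {a : V} (p : H.Walk a a), H.Reachable u a → ∀ x ∈ p.edges, x ∈ J := by
    intro a p ha x hx
    refine ⟨p.edges_subset_edgeSet hx, fun w hw => ?_⟩
    exact ha.trans (p.takeUntil w (SimpleGraph.Walk.mem_support_of_mem_edges hx hw)).reachable
  have heJ : e ∈ J := hmem c .rfl e he
  have hfJ : f ∈ J := hmem d huv f hf
  have hef : f ≠ e := fun h => hed (h ▸ hf)
  have h1 : {x ∈ H2.edgeSet | ∀ w ∈ x, H.Reachable u w} ⊆ (J \ {e}) \ {f} := by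
    rintro x ⟨hx, hxw⟩
    rw [hH2, SimpleGraph.edgeSet_deleteEdges, SimpleGraph.edgeSet_deleteEdges] at hx
    exact ⟨⟨⟨hx.1.1, hxw⟩, hx.1.2⟩, hx.2⟩
  have h2 := ncard_le_ncard h1
  have h3 := ncard_sdiff_singleton_add_one heJ
  have h4 := ncard_sdiff_singleton_add_one (show f ∈ J \ {e} from ⟨hfJ, hef⟩)
  have h5 : J.ncard ≤ (edgeEnds J).ncard := hI J fun x hx => hH hx.1
  have h6 : (edgeEnds J).ncard ≤ {w | H.Reachable u w}.ncard := by
    refine ncard_le_ncard ?_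
    rintro w ⟨x, hx, hw⟩
    exact hx.2 w hw
  omega

theorem exists_isCycle_of_ncard_le [Finite V] {J : Set (Sym2 V)} (hne : J.Nonempty)
    (hd : ∀ e ∈ J, ¬ e.IsDiag) (h : (edgeEnds J).ncard ≤ J.ncard) :
    ∃ (u : V) (c : (SimpleGraph.fromEdgeSet J).Walk u u), c.IsCycle := by
  by_contra! hcon
  have := ncard_add_one_le_of_isAcyclic hne hd hcon
  omega

namespace SimpleGraph

/-- The bicircular matroid of a finite graph. -/
def bicircularMatroid [Finite V] (G : SimpleGraph V) : Matroid (Sym2 V) :=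
  transversalMatroid (fun e v => v ∈ e) G.edgeSet

variable [Finite V] {G : SimpleGraph V}

theorem bicircularMatroid_indep_iff {I : Set (Sym2 V)} :
    G.bicircularMatroid.Indep I ↔ I ⊆ G.edgeSet ∧ HallOn (fun e v => v ∈ e) I := Iff.rfl

theorem ncard_le_of_bicircularMatroid_indep {I : Set (Sym2 V)} (h : G.bicircularMatroid.Indep I) :
    I.ncard ≤ (edgeEnds I).ncard := h.2 I Subset.rfl

theorem ncard_eq_of_bicircularMatroid_isCircuit {C : Set (Sym2 V)}
    (h : G.bicircularMatroid.IsCircuit C) :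
    C.ncard = (edgeEnds C).ncard + 1 ∧ ∀ e ∈ C, edgeEnds (C \ {e}) = edgeEnds C := by
  have hdep := h.dep.not_indep
  have hlt : (edgeEnds C).ncard < C.ncard := by
    by_contra hle
    refine hdep ⟨h.subset_ground, fun J hJ => ?_⟩
    rcases hJ.eq_or_ssubset with rfl | hJ
    · exact not_lt.1 hle
    · exact ncard_le_of_bicircularMatroid_indep (h.ssubset_indep hJ)
  have hstep : ∀ e ∈ C, C.ncard ≤ (edgeEnds (C \ {e})).ncard + 1 ∧
      edgeEnds (C \ {e}) = edgeEnds C := by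
    intro e he
    have h1 := ncard_le_of_bicircularMatroid_indep (h.sdiff_singleton_indep he)
    have h2 := ncard_sdiff_singleton_add_one he
    exact ⟨by omega, eq_of_subset_of_ncard_le (edgeEnds_mono sdiff_subset) (by omega)⟩
  refine ⟨?_, fun e he => (hstep e he).2⟩
  obtain ⟨e, he⟩ := h.nonempty
  obtain ⟨h1, h2⟩ := hstep e he
  rw [h2] at h1
  omega

theorem isBicircularMatroidOf_bicircularMatroid :
    G.bicircularMatroid.IsBicircularMatroidOf G := by
  refine ⟨rfl, fun I hI => ⟨fun hind u v c d hc hd huv => ?_, fun h => ?_⟩⟩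
  · have hH : (SimpleGraph.fromEdgeSet I).edgeSet ⊆ I := by
      rw [SimpleGraph.edgeSet_fromEdgeSet]
      exact sdiff_subset
    ext e
    exact ⟨hind.2.mem_edges_of_isCycle hH hc hd huv,
      hind.2.mem_edges_of_isCycle hH hd hc huv.symm⟩
  · classical
    by_contra hdep
    obtain ⟨J, hJI, hJ⟩ :=
      ((Matroid.not_indep_iff (M := G.bicircularMatroid) hI).1 hdep).exists_isCircuit_subset
    have hdiag : ∀ e ∈ J, ¬ e.IsDiag := fun e he => G.not_isDiag_of_mem_edgeSet (hI (hJI he))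
    obtain ⟨hcard, hends⟩ := ncard_eq_of_bicircularMatroid_isCircuit hJ
    obtain ⟨u, c, hc⟩ := exists_isCycle_of_ncard_le hJ.nonempty hdiag (by omega)
    obtain ⟨e, he⟩ := List.exists_mem_of_ne_nil c.edges (by
      rw [ne_eq, SimpleGraph.Walk.edges_eq_nil]
      exact hc.not_nil)
    have hHJ : ∀ x ∈ (SimpleGraph.fromEdgeSet J).edgeSet, x ∈ J := fun x hx => by
      rw [SimpleGraph.edgeSet_fromEdgeSet] at hx
      exact hx.1
    have heJ : e ∈ J := hHJ e (c.edges_subset_edgeSet he)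
    -- all edges of the circuit are in one connected component
    have hconn : ∀ x ∈ J, ∀ w ∈ x, (SimpleGraph.fromEdgeSet J).Reachable u w := by
      set K := {x ∈ J | ∀ w ∈ x, (SimpleGraph.fromEdgeSet J).Reachable u w} with hK
      have heK : e ∈ K := ⟨heJ, fun w hw =>
        (c.takeUntil w (SimpleGraph.Walk.mem_support_of_mem_edges he hw)).reachable⟩
      have hreach : ∀ x ∈ J, ∀ a ∈ x, ∀ b ∈ x,
          (SimpleGraph.fromEdgeSet J).Reachable u a →
          (SimpleGraph.fromEdgeSet J).Reachable u b := by
        intro x hx a ha b hb h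
        by_cases hab : a = b
        · exact hab ▸ h
        · refine h.trans (SimpleGraph.Adj.reachable ?_)
          rw [SimpleGraph.fromEdgeSet_adj]
          exact ⟨((Sym2.mem_and_mem_iff hab).1 ⟨ha, hb⟩) ▸ hx, hab⟩
      have hKJ : K ⊆ J := sep_subset _ _
      suffices hKJ' : K = J by
        intro x hx
        rw [← hKJ'] at hx
        exact hx.2
      by_contra hne
      have hss : K ⊂ J := hKJ.ssubset_of_ne hne
      have h1 := ncard_le_of_bicircularMatroid_indep (hJ.ssubset_indep hss)
      have h2 := ncard_le_of_bicircularMatroid_indep (hJ.ssubset_indep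
        (show J \ K ⊂ J from sdiff_subset.ssubset_of_ne fun h =>
          (h.ge heJ).2 heK))
      have h3 := ncard_sdiff_add_ncard_of_subset hKJ
      have h4 : Disjoint (edgeEnds K) (edgeEnds (J \ K)) := by
        rw [Set.disjoint_left]
        rintro w ⟨x, hx, hwx⟩ ⟨y, hy, hwy⟩
        exact hy.2 ⟨hy.1, fun z hz => hreach y hy.1 w hwy z hz (hx.2 w hwx)⟩
      have h5 := ncard_union_eq h4
      rw [← edgeEnds_union, union_sdiff_cancel hKJ] at h5
      omega
    have hne : (J \ {e}).Nonempty := by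
      rw [nonempty_iff_ne_empty]
      intro h0
      have h1 := hends e heJ
      have h2 : e.out.1 ∈ edgeEnds J := ⟨e, heJ, Sym2.out_fst_mem e⟩
      rw [← h1, h0] at h2
      obtain ⟨_, h, _⟩ := h2
      exact h
    obtain ⟨v, d, hd⟩ := exists_isCycle_of_ncard_le hne (fun x hx => hdiag x hx.1) (by
      rw [hends e heJ]
      have := ncard_sdiff_singleton_add_one heJ
      omega)
    have hed : e ∉ d.edges := fun h => by
      have := d.edges_subset_edgeSet h
      rw [SimpleGraph.edgeSet_fromEdgeSet] at this
      exact this.1.2 rfl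
    have hv : (SimpleGraph.fromEdgeSet J).Reachable u v := by
      obtain ⟨f, hf⟩ := List.exists_mem_of_ne_nil d.edges (by
        rw [ne_eq, SimpleGraph.Walk.edges_eq_nil]
        exact hd.not_nil)
      have hfJ := d.edges_subset_edgeSet hf
      rw [SimpleGraph.edgeSet_fromEdgeSet] at hfJ
      have hw := Sym2.out_fst_mem f
      have h1 := hconn f hfJ.1.1 _ hw
      have h2 := (d.takeUntil _ (SimpleGraph.Walk.mem_support_of_mem_edges hf hw)).reachable
      exact h1.trans (h2.mono (SimpleGraph.fromEdgeSet_mono sdiff_subset)).symm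
    have hJI' : SimpleGraph.fromEdgeSet J ≤ SimpleGraph.fromEdgeSet I :=
      SimpleGraph.fromEdgeSet_mono hJI
    have hJI'' : SimpleGraph.fromEdgeSet (J \ {e}) ≤ SimpleGraph.fromEdgeSet I :=
      SimpleGraph.fromEdgeSet_mono (sdiff_subset.trans hJI)
    have key := h u v (c.mapLe hJI') (d.mapLe hJI'') (hc.mapLe hJI') (hd.mapLe hJI'')
      (hv.mono hJI')
    simp only [SimpleGraph.Walk.edges_mapLe_eq_edges] at key
    exact hed (key ▸ he : e ∈ {x | x ∈ d.edges})

theorem isGammoid_bicircularMatroid : G.bicircularMatroid.IsGammoid := by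
  let D : Digraph (Sym2 V ⊕ V) := ⟨fun x y => ∃ e v, x = Sum.inl e ∧ y = Sum.inr v ∧ v ∈ e⟩
  refine ⟨Sym2 V ⊕ V, inferInstance, D, range Sum.inr, Sum.inl, Sum.inl_injective.injOn,
    fun I hI => ?_⟩
  rw [bicircularMatroid_indep_iff, hallOn_iff_exists_injective]
  constructor
  · rintro ⟨-, f, hf, hfI⟩
    classical
    refine ⟨fun x => Sum.elim (fun e => if h : e ∈ I then [Sum.inr (f ⟨e, h⟩)] else [])
      (fun _ => []) x, ?_, ?_⟩
    · rintro _ ⟨e, he, rfl⟩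
      simp only [Sum.elim_inl, he, dite_true]
      refine ⟨by simp, ?_, by simp⟩
      rw [List.isChain_pair]
      exact ⟨e, _, rfl, rfl, hfI ⟨e, he⟩⟩
    · rintro _ ⟨e, he, rfl⟩ _ ⟨e', he', rfl⟩ hne
      simp only [Sum.elim_inl, he, he', dite_true]
      have hne' : e ≠ e' := fun h => hne (h ▸ rfl)
      simp only [List.disjoint_cons_left, List.mem_cons, Sum.inl.injEq, reduceCtorEq,
        List.not_mem_nil, or_false, Sum.inr.injEq, List.disjoint_nil_left, and_true, false_or]
      exact ⟨hne', fun h => hne' (by simpa using hf h)⟩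
  · rintro ⟨p, hp, hdisj⟩
    refine ⟨hI, ?_⟩
    have key : ∀ e : I, ∃ v, Sum.inr v ∈ p (Sum.inl (e : Sym2 V)) ∧ v ∈ (e : Sym2 V) := by
      rintro ⟨e, he⟩
      obtain ⟨-, h2, h3⟩ := hp (Sum.inl e) ⟨e, he, rfl⟩
      rcases hpe : p (Sum.inl e) with _ | ⟨x, l⟩
      · simp [hpe] at h3
      · rw [hpe] at h2
        obtain ⟨e', v, h4, rfl, h5⟩ := h2.rel
        obtain rfl := Sum.inl_injective h4
        exact ⟨v, by simp, h5⟩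
    choose f hf using key
    refine ⟨f, fun e e' h => ?_, fun e => (hf e).2⟩
    by_contra hne
    refine hdisj (Sum.inl (e : Sym2 V)) ⟨e, e.2, rfl⟩ (Sum.inl (e' : Sym2 V)) ⟨e', e'.2, rfl⟩
      (fun h => hne (Subtype.ext (Sum.inl_injective h)))
      (List.mem_cons_of_mem _ (hf e).1) ?_
    rw [h]
    exact List.mem_cons_of_mem _ (hf e').1

end SimpleGraph

end Bicircular

section PositiveDoubleCircuits

variable {V : Type u}

theorem sum_card_filter_mem_le [DecidableEq V] (S : Finset V) (J : Finset (Sym2 V)) :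
    ∑ v ∈ S, (J.filter fun e => v ∈ e).card ≤ 2 * J.card := by
  have h := Finset.sum_card_bipartiteAbove_eq_sum_card_bipartiteBelow (s := S) (t := J)
    (fun v e => v ∈ e)
  simp only [Finset.bipartiteAbove, Finset.bipartiteBelow] at h
  rw [h, mul_comm, ← smul_eq_mul]
  refine Finset.sum_le_card_nsmul _ _ _ fun e _ => ?_
  induction e with
  | _ a b =>
    refine (Finset.card_le_card (t := {a, b}) fun v hv => ?_).trans Finset.card_le_two
    simpa using (Finset.mem_filter.1 hv).2

theorem Matroid.IsDoubleCircuit.exists_indep {α : Type u} {M : Matroid α} [M.Finite] {D : Set α}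
    (hD : M.IsDoubleCircuit D) : ∃ I ⊆ D, M.Indep I ∧ (D \ I).ncard = 2 := by
  obtain ⟨hDE, hr, -⟩ := hD
  have hfin := M.ground_finite.subset hDE
  obtain ⟨I, hI⟩ := M.exists_isBasis D
  refine ⟨I, hI.subset, hI.indep, ?_⟩
  rw [hI.eRk_eq_encard, ← encard_sdiff_add_encard_of_subset hI.subset,
    ← (hfin.subset hI.subset).cast_ncard_eq, ← (hfin.subset sdiff_subset).cast_ncard_eq] at hr
  norm_cast at hr
  omega

theorem Matroid.IsDoubleCircuit.exists_isCircuit_notMem {α : Type u} {M : Matroid α} [M.Finite]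
    {D : Set α} (hD : M.IsDoubleCircuit D) {d : α} (hd : d ∈ D) :
    ∃ C, M.IsCircuit C ∧ C ⊆ D ∧ d ∉ C := by
  obtain ⟨hDE, hr, hcl⟩ := hD
  have hfin := M.ground_finite.subset hDE
  have hdep : ¬ M.Indep (D \ {d}) := by
    intro h
    have h1 := hcl d hd
    rw [h.eRk_eq_encard] at h1
    rw [← h1, ← encard_sdiff_singleton_add_one hd,
      ← (hfin.subset sdiff_subset).cast_ncard_eq] at hr
    norm_cast at hr
    omega
  obtain ⟨C, hC, hCc⟩ :=
    ((M.not_indep_iff (sdiff_subset.trans hDE)).1 hdep).exists_isCircuit_subset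
  exact ⟨C, hCc, hC.trans sdiff_subset, fun h => (hC h).2 rfl⟩

theorem Matroid.IsDoubleCircuit.exists_isCircuit_mem {α : Type u} {M : Matroid α} [M.Finite]
    {D : Set α} (hD : M.IsDoubleCircuit D) {d : α} (hd : d ∈ D) :
    ∃ C, M.IsCircuit C ∧ C ⊆ D ∧ d ∈ C := by
  obtain ⟨hDE, hr, hcl⟩ := hD
  have hfin := M.ground_finite.subset hDE
  have hmem : d ∈ M.closure (D \ {d}) := by
    by_contra h
    have h1 := M.eRk_insert_eq_add_one ⟨hDE hd, h⟩
    rw [insert_sdiff_singleton, insert_eq_of_mem hd, hcl d hd] at h1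
    have h2 : M.eRk D ≠ ⊤ := ne_top_of_le_ne_top hfin.encard_lt_top.ne (M.eRk_le_encard D)
    obtain ⟨n, hn⟩ := ENat.ne_top_iff_exists.1 h2
    rw [← hn] at h1
    norm_cast at h1
    omega
  obtain ⟨C, hC, hCc, hdC⟩ := (M.mem_closure_iff_exists_isCircuit (by simp)).1 hmem
  rw [insert_sdiff_singleton, insert_eq_of_mem hd] at hC
  exact ⟨C, hCc, hC, hdC⟩

namespace SimpleGraph

variable [Finite V] {G : SimpleGraph V}

instance : G.bicircularMatroid.Finite := ⟨toFinite _⟩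

theorem isAcyclic_of_five_le_egirth (hG : 5 ≤ G.egirth) {F : Set (Sym2 V)} (hF : F ⊆ G.edgeSet)
    {W : Set V} (hFW : edgeEnds F ⊆ W) (hW : W.ncard ≤ 4) :
    (SimpleGraph.fromEdgeSet F).IsAcyclic := by
  classical
  intro u w hw
  have hle : SimpleGraph.fromEdgeSet F ≤ G := by
    intro a b hab
    rw [SimpleGraph.fromEdgeSet_adj] at hab
    exact hF hab.1
  have h1 := hG.trans (SimpleGraph.egirth_le_length (hw.mapLe hle))
  have h2 : w.length ≤ W.ncard := by
    have h3 : w.support.tail.length = w.length := by simp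
    rw [← h3, ← List.toFinset_card_of_nodup hw.support_nodup, ← ncard_coe_finset]
    refine ncard_le_ncard fun v hv => hFW ?_
    have hv' : v ∈ w.support := List.mem_of_mem_tail (by simpa using hv)
    obtain ⟨e, he, hve⟩ :=
      (SimpleGraph.Walk.mem_support_iff_exists_mem_edges_of_not_nil hw.not_nil).1 hv'
    have := w.edges_subset_edgeSet he
    rw [SimpleGraph.edgeSet_fromEdgeSet] at this
    exact ⟨e, this.1, hve⟩
  rw [SimpleGraph.Walk.length_map] at h1
  have : 5 ≤ w.length := by exact_mod_cast h1
  omega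

/-- The edges that are singular classes of the circuit partition of a double circuit have their
ends among at most four vertices, those of degree at least three. -/
theorem exists_ncard_le_four_of_isDoubleCircuit {D : Set (Sym2 V)}
    (hD : G.bicircularMatroid.IsDoubleCircuit D) :
    ∃ W : Set V, W.ncard ≤ 4 ∧
      edgeEnds {e | {e} ∈ G.bicircularMatroid.circuitPartition D} ⊆ W := by
  classical
  have := Fintype.ofFinite V
  have hdeg2 : ∀ v ∈ edgeEnds D, ∀ e ∈ D, ∃ e' ∈ D, e' ≠ e ∧ v ∈ e' := by
    rintro v ⟨x, hx, hvx⟩ e he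
    by_cases hxe : x = e
    · subst hxe
      obtain ⟨C, hC, hCD, hxC⟩ := hD.exists_isCircuit_mem hx
      have h1 : v ∈ edgeEnds C := ⟨x, hxC, hvx⟩
      rw [← (ncard_eq_of_bicircularMatroid_isCircuit hC).2 x hxC] at h1
      obtain ⟨y, hy, hvy⟩ := h1
      exact ⟨y, hCD hy.1, hy.2, hvy⟩
    · exact ⟨x, hx, hxe, hvx⟩
  let d : V → ℕ := fun v => (D.toFinset.filter fun e => v ∈ e).card
  have hd2 : ∀ v ∈ (edgeEnds D).toFinset, 2 ≤ d v := by
    intro v hv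
    rw [mem_toFinset] at hv
    obtain ⟨x, hx, hvx⟩ := hv
    obtain ⟨y, hy, hyx, hvy⟩ := hdeg2 v ⟨x, hx, hvx⟩ x hx
    exact Finset.one_lt_card.2 ⟨x, by simp [hx, hvx], y, by simp [hy, hvy], hyx.symm⟩
  refine ⟨{v ∈ edgeEnds D | 3 ≤ d v}, ?_, ?_⟩
  · have h1 := sum_card_filter_mem_le (edgeEnds D).toFinset D.toFinset
    have h2 : ∑ v ∈ (edgeEnds D).toFinset, (2 + if 3 ≤ d v then 1 else 0) ≤
        ∑ v ∈ (edgeEnds D).toFinset, d v := by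
      refine Finset.sum_le_sum fun v hv => ?_
      have := hd2 v hv
      split_ifs <;> omega
    rw [Finset.sum_add_distrib, Finset.sum_const, smul_eq_mul, ← Finset.card_filter] at h2
    have h3 := h2.trans h1
    obtain ⟨I, hID, hI, hcard⟩ := hD.exists_indep
    have h4 := ncard_le_of_bicircularMatroid_indep hI
    have h5 := ncard_le_ncard (edgeEnds_mono hID)
    have h6 := ncard_sdiff_add_ncard_of_subset hID
    have h7 : {v ∈ edgeEnds D | 3 ≤ d v}.ncard =
        ((edgeEnds D).toFinset.filter fun v => 3 ≤ d v).card := by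
      rw [← ncard_coe_finset]
      congr 1
      ext v
      simp
    rw [← ncard_eq_toFinset_card', ← ncard_eq_toFinset_card'] at h3
    omega
  · rintro v ⟨e, ⟨C, hC, hCD, heC⟩, hve⟩
    have heD : e ∈ D \ C := heC ▸ rfl
    have hmem : ∀ x ∈ D, x ≠ e → x ∈ C := by
      intro x hx hxe
      by_contra hxC
      exact hxe (heC.ge ⟨hx, hxC⟩)
    have hv : v ∈ edgeEnds D := ⟨e, heD.1, hve⟩
    refine ⟨hv, ?_⟩
    obtain ⟨x, hx, hxe, hvx⟩ := hdeg2 v hv e heD.1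
    have hxC := hmem x hx hxe
    have h1 : v ∈ edgeEnds C := ⟨x, hxC, hvx⟩
    rw [← (ncard_eq_of_bicircularMatroid_isCircuit hC).2 x hxC] at h1
    obtain ⟨y, hy, hvy⟩ := h1
    have hye : y ≠ e := fun h => heD.2 (h ▸ hy.1)
    exact Finset.two_lt_card.2 ⟨e, by simp [heD.1, hve], x, by simp [hx, hvx], y,
      by simp [hCD hy.1, hvy], hxe.symm, hye.symm, fun h => hy.2 h.symm⟩

theorem not_hasPositiveDoubleCircuit_bicircularMatroid (hG : 5 ≤ G.egirth) :
    ¬ G.bicircularMatroid.HasPositiveDoubleCircuit := by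
  rintro ⟨D, hD, hpos⟩
  set P := G.bicircularMatroid.circuitPartition D with hP
  set F : Set (Sym2 V) := {e | {e} ∈ P} with hF
  obtain ⟨W, hW, hFW⟩ := exists_ncard_le_four_of_isDoubleCircuit hD
  have hFD : F ⊆ D := by
    rintro e ⟨C, -, -, heC⟩
    exact (heC.le rfl).1
  have hDE : D ⊆ G.edgeSet := hD.1
  have hforest : ∀ F' ⊆ F, F'.Nonempty → F'.ncard + 1 ≤ (edgeEnds F').ncard := fun F' hF' hne =>
    ncard_add_one_le_of_isAcyclic hne
      (fun e he => G.not_isDiag_of_mem_edgeSet (hDE (hFD (hF' he))))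
      (isAcyclic_of_five_le_egirth hG ((hF'.trans hFD).trans hDE)
        ((edgeEnds_mono hF').trans hFW) hW)
  have hcirc : ∀ C, G.bicircularMatroid.IsCircuit C → ¬ C ⊆ F := by
    intro C hC hCF
    have h1 := hforest C hCF hC.nonempty
    have h2 := (ncard_eq_of_bicircularMatroid_isCircuit hC).1
    omega
  have hsing : {Q ∈ P | Q.encard = 1} = (fun e => {e}) '' F := by
    ext Q
    simp only [mem_ofPred_eq, mem_image, encard_eq_one]
    constructor
    · rintro ⟨h1, e, rfl⟩
      exact ⟨e, h1, rfl⟩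
    · rintro ⟨e, he, rfl⟩
      exact ⟨he, e, rfl⟩
  rw [Matroid.MoreSingular, hsing, (singleton_injective).encard_image, ← (toFinite _).cast_ncard_eq,
    ← (toFinite F).cast_ncard_eq, Nat.cast_lt] at hpos
  set m := {Q ∈ P | Q.encard ≠ 1} with hm
  have hFne : F.Nonempty := nonempty_of_ncard_ne_zero (by omega)
  have hF3 : F.ncard ≤ 3 := by
    have h1 := hforest F Subset.rfl hFne
    have h2 : (edgeEnds F).ncard ≤ W.ncard := ncard_le_ncard hFW
    omega
  have hcover : ∀ x ∈ D, x ∉ F → ∃ Q ∈ m, x ∈ Q := by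
    intro x hx hxF
    obtain ⟨C, hC, hCD, hxC⟩ := hD.exists_isCircuit_notMem hx
    refine ⟨D \ C, ⟨⟨C, hC, hCD, rfl⟩, fun h1 => ?_⟩, hx, hxC⟩
    obtain ⟨y, hy⟩ := encard_eq_one.1 h1
    obtain rfl : x = y := hy.le ⟨hx, hxC⟩
    exact hxF ⟨C, hC, hCD, hy.symm⟩
  have hFC : ∀ C, G.bicircularMatroid.IsCircuit C → C ⊆ D → D \ C ∈ m → F ⊆ C := by
    rintro C hC hCD hQ e ⟨C', hC', -, heC'⟩
    by_contra heC
    refine hQ.2 ?_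
    have hCC' : C ⊆ C' := by
      intro x hx
      by_contra hxC'
      exact heC ((heC'.ge ⟨hCD hx, hxC'⟩ : x = e) ▸ hx)
    rw [hC.eq_of_subset_isCircuit hC' hCC', ← heC']
    exact encard_singleton e
  have hm3 : m.ncard = 0 ∨ m.ncard = 1 ∨ m.ncard = 2 := by omega
  rcases hm3 with h0 | h1 | h2
  · rw [ncard_eq_zero] at h0
    obtain ⟨e, he⟩ := hFne
    obtain ⟨C, hC, hCD, -⟩ := hD.exists_isCircuit_notMem (hFD he)
    refine hcirc C hC fun x hx => ?_
    by_contra hxF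
    obtain ⟨Q, hQ, -⟩ := hcover x (hCD hx) hxF
    rw [h0] at hQ
    exact hQ
  · rw [ncard_eq_one] at h1
    obtain ⟨Q, hQ⟩ := h1
    obtain ⟨C, hC, hCD, rfl⟩ : Q ∈ P := (hQ.ge rfl : Q ∈ m).1
    refine hcirc C hC fun x hx => ?_
    by_contra hxF
    obtain ⟨Q', hQ', hxQ'⟩ := hcover x (hCD hx) hxF
    rw [hQ, mem_singleton_iff] at hQ'
    exact (hQ' ▸ hxQ' : x ∈ D \ C).2 hx
  · rw [ncard_eq_two] at h2
    obtain ⟨Q₁, Q₂, -, hQ⟩ := h2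
    have hQ₁ : Q₁ ∈ m := hQ.ge (Or.inl rfl)
    have hQ₂ : Q₂ ∈ m := hQ.ge (Or.inr rfl)
    obtain ⟨C₁, hC₁, hC₁D, rfl⟩ := hQ₁.1
    obtain ⟨C₂, hC₂, hC₂D, rfl⟩ := hQ₂.1
    have hinter : C₁ ∩ C₂ = F := by
      refine subset_antisymm (fun x hx => ?_)
        (subset_inter (hFC _ hC₁ hC₁D hQ₁) (hFC _ hC₂ hC₂D hQ₂))
      by_contra hxF
      obtain ⟨Q', hQ', hxQ'⟩ := hcover x (hC₁D hx.1) hxF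
      rw [hQ] at hQ'
      rcases hQ' with rfl | rfl
      exacts [hxQ'.2 hx.1, hxQ'.2 hx.2]
    obtain ⟨I, hID, hI, hcard⟩ := hD.exists_indep
    have h3 := ncard_union_add_ncard_inter C₁ C₂
    have h4 := ncard_union_add_ncard_inter (edgeEnds C₁) (edgeEnds C₂)
    rw [hinter] at h3
    rw [← edgeEnds_union] at h4
    have h5 : (edgeEnds F).ncard ≤ (edgeEnds C₁ ∩ edgeEnds C₂).ncard :=
      ncard_le_ncard (subset_inter (edgeEnds_mono (hFC _ hC₁ hC₁D hQ₁))
        (edgeEnds_mono (hFC _ hC₂ hC₂D hQ₂)))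
    have h6 := hforest F Subset.rfl hFne
    have h7 := (ncard_eq_of_bicircularMatroid_isCircuit hC₁).1
    have h8 := (ncard_eq_of_bicircularMatroid_isCircuit hC₂).1
    have h9 := ncard_le_of_bicircularMatroid_indep
      (hI.subset (inter_subset_right (s := C₁ ∪ C₂) (t := I)))
    have h10 : (edgeEnds ((C₁ ∪ C₂) ∩ I)).ncard ≤ (edgeEnds (C₁ ∪ C₂)).ncard :=
      ncard_le_ncard (edgeEnds_mono inter_subset_left)
    have h11 := ncard_inter_add_ncard_sdiff_eq_ncard (C₁ ∪ C₂) I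
    have h12 : ((C₁ ∪ C₂) \ I).ncard ≤ (D \ I).ncard :=
      ncard_le_ncard (sdiff_subset_sdiff_left (union_subset hC₁D hC₂D))
    omega

/-- The bicircular matroid of a graph of minimum degree at least three is cosimple. -/
theorem isCosimple_bicircularMatroid
    (hdeg : ∀ v, 3 ≤ (G.incidenceSet v).ncard) : G.bicircularMatroid.IsCosimple := by
  classical
  have := Fintype.ofFinite V
  intro C hC
  by_contra! hlt
  have hC2 : C.ncard ≤ 2 := by
    rw [← (toFinite C).cast_ncard_eq] at hlt
    have : C.ncard < 3 := by exact_mod_cast hlt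
    omega
  -- a matching of the vertices to incident edges outside of `C`
  have hall : HallOn (fun v e => e ∈ G.incidenceSet v ∧ e ∉ C) (univ : Set V) := by
    intro S _
    set E := ⋃ v ∈ S, G.incidenceSet v with hE
    have hN : nbhd (fun v e => e ∈ G.incidenceSet v ∧ e ∉ C) S = E \ C := by
      ext e
      simp only [nbhd, hE, mem_ofPred_eq, mem_sdiff, mem_iUnion, exists_prop]
      exact ⟨fun ⟨v, h1, h2, h3⟩ => ⟨⟨v, h1, h2⟩, h3⟩, fun ⟨⟨v, h1, h2⟩, h3⟩ => ⟨v, h1, h2, h3⟩⟩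
    rw [hN]
    have h1 : E.ncard - C.ncard ≤ (E \ C).ncard := le_ncard_sdiff C E
    have hsum : 3 * S.ncard ≤ 2 * E.ncard := by
      have h2 := sum_card_filter_mem_le S.toFinset E.toFinset
      rw [← ncard_eq_toFinset_card'] at h2
      refine le_trans ?_ h2
      rw [ncard_eq_toFinset_card', mul_comm, ← smul_eq_mul]
      refine Finset.card_nsmul_le_sum _ _ _ fun v hv => (hdeg v).trans ?_
      rw [← ncard_coe_finset]
      refine ncard_le_ncard fun e he => ?_
      simp only [Finset.coe_filter, mem_toFinset, mem_ofPred_eq]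
      exact ⟨mem_biUnion (mem_toFinset.1 hv) he, he.2⟩
    have hone : S.ncard = 1 → 3 ≤ E.ncard := by
      intro hS
      obtain ⟨x, rfl⟩ := ncard_eq_one.1 hS
      have h7 : E = G.incidenceSet x := by simp [hE]
      rw [h7]
      exact hdeg x
    have htwo : S.ncard = 2 → 5 ≤ E.ncard := by
      intro hS
      obtain ⟨x, y, hxy, rfl⟩ := ncard_eq_two.1 hS
      have h3 := ncard_union_add_ncard_inter (G.incidenceSet x) (G.incidenceSet y)
      have h4 : (G.incidenceSet x ∩ G.incidenceSet y).ncard ≤ 1 :=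
        (ncard_le_ncard (G.incidenceSet_inter_incidenceSet_subset hxy)).trans
          (ncard_singleton _).le
      have h5 := hdeg x
      have h6 := hdeg y
      have h7 : E = G.incidenceSet x ∪ G.incidenceSet y := by simp [hE]
      rw [h7]
      omega
    omega
  obtain ⟨g, hg, hgr⟩ := hallOn_iff_exists_injective.1 hall
  have hind : G.bicircularMatroid.Indep (range g) := by
    refine ⟨?_, hallOn_iff_exists_injective.2 ⟨fun e => (Equiv.ofInjective g hg).symm e,
      Subtype.val_injective.comp (Equiv.ofInjective g hg).symm.injective, ?_⟩⟩
    · rintro _ ⟨v, rfl⟩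
      exact (hgr v).1.1
    · intro e
      have h1 := (hgr ((Equiv.ofInjective g hg).symm e)).1.2
      rwa [Equiv.apply_ofInjective_symm hg] at h1
  obtain ⟨B, hB, hgB⟩ := hind.exists_isBase_superset
  have hBg : range g = B := by
    refine eq_of_subset_of_ncard_le hgB ?_
    have h1 := ncard_le_of_bicircularMatroid_indep hB.indep
    have h2 := ncard_le_ncard (subset_univ (edgeEnds B))
    rw [← Nat.card_coe_set_eq (range g), Nat.card_range_of_injective hg, Nat.card_coe_set_eq]
    exact h1.trans h2
  refine hC.not_indep ?_
  refine (Matroid.dual_indep_iff_exists (M := G.bicircularMatroid) hC.subset_ground).2 ?_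
  refine ⟨B, hB, ?_⟩
  rw [← hBg, Set.disjoint_right]
  rintro _ ⟨v, rfl⟩
  exact (hgr v).2

theorem bicircularMatroid_indep_singleton {e : Sym2 V} (he : e ∈ G.edgeSet) :
    G.bicircularMatroid.Indep {e} := by
  refine ⟨singleton_subset_iff.2 he, hallOn_iff_exists_injective.2
    ⟨fun e => (e : Sym2 V).out.1, fun a b _ => Subsingleton.elim a b, fun e => ?_⟩⟩
  exact Sym2.out_fst_mem _

end SimpleGraph

theorem Matroid.IsCosimple.two_le_corank {α : Type u} {M : Matroid α} [M.Finite]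
    (hM : M.IsCosimple) (hne : M.E.Nonempty) (hloop : ∀ e ∈ M.E, M.Indep {e}) :
    2 ≤ M.corank := by
  have hsmall : ∀ X ⊆ M.E, X.encard ≤ 2 → M✶.Indep X := by
    intro X hX hcard
    by_contra hdep
    obtain ⟨C, hCX, hC⟩ := ((M✶.not_indep_iff hX).1 hdep).exists_isCircuit_subset
    have h1 := (hM C hC).trans ((encard_le_encard hCX).trans hcard)
    exact absurd h1 (by decide)
  obtain ⟨e, he⟩ := hne
  have h1 := (hloop e he).encard_le_eRank
  have h2 := (hsmall {e} (singleton_subset_iff.2 he) (by simp)).encard_le_eRank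
  rw [encard_singleton] at h1 h2
  have h3 := add_le_add h1 h2
  rw [M.eRank_add_eRank_dual, one_add_one_eq_two] at h3
  obtain ⟨X, hX, hX2⟩ := exists_subset_encard_eq h3
  rw [corank, ← hX2]
  exact (hsmall X hX hX2.le).encard_le_eRank

theorem SimpleGraph.isDoubleCircuitCounterexample_bicircularMatroid [Finite V] {G : SimpleGraph V}
    (hG : 5 ≤ G.egirth) (hcos : G.bicircularMatroid.IsCosimple) (hne : G.edgeSet.Nonempty) :
    G.bicircularMatroid.IsDoubleCircuitCounterexample :=
  ⟨isGammoid_bicircularMatroid, hcos,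
    hcos.two_le_corank hne fun _ he => bicircularMatroid_indep_singleton he,
    not_hasPositiveDoubleCircuit_bicircularMatroid hG⟩

end PositiveDoubleCircuits

section Petersen

theorem SimpleGraph.Walk.exists_eq_of_length_eq_three {V : Type u} {G : SimpleGraph V} {u : V}
    (w : G.Walk u u) (h : w.length = 3) : ∃ a b, G.Adj u a ∧ G.Adj a b ∧ G.Adj b u := by
  match w, h with
  | .cons h1 (.cons h2 (.cons h3 .nil)), _ => exact ⟨_, _, h1, h2, h3⟩

theorem SimpleGraph.Walk.IsCycle.exists_eq_of_length_eq_four {V : Type u} {G : SimpleGraph V}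
    {u : V} {w : G.Walk u u} (hw : w.IsCycle) (h : w.length = 4) :
    ∃ a b c, G.Adj u a ∧ G.Adj a b ∧ G.Adj b c ∧ G.Adj c u ∧ u ≠ b ∧ a ≠ c := by
  match w, h, hw with
  | .cons h1 (.cons h2 (.cons h3 (.cons h4 .nil))), _, hw =>
    have := hw.support_nodup
    simp only [SimpleGraph.Walk.support_cons, SimpleGraph.Walk.support_nil, List.tail_cons,
      List.nodup_cons, List.mem_cons, not_or] at this
    exact ⟨_, _, _, h1, h2, h3, h4, fun h => this.2.1.2.1 h.symm, this.1.2.1⟩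

theorem five_le_egirth_petersenGraph : 5 ≤ petersenGraph.egirth := by
  rw [SimpleGraph.le_egirth]
  intro u w hw
  have h3 := hw.three_le_length
  have hcard : ∀ s : Finset (Fin 5), s.card ≤ 5 := fun s => by simpa using s.card_le_univ
  have hne3 : w.length ≠ 3 := by
    intro h
    obtain ⟨a, b, hua, hab, hbu⟩ := w.exists_eq_of_length_eq_three h
    have h1 : Disjoint (u.1 ∪ a.1) b.1 := Finset.disjoint_union_left.2 ⟨hbu.symm, hab⟩
    have h2 := hcard ((u.1 ∪ a.1) ∪ b.1)
    rw [Finset.card_union_of_disjoint h1, Finset.card_union_of_disjoint hua, u.2, a.2, b.2] at h2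
    omega
  have hne4 : w.length ≠ 4 := by
    intro h
    obtain ⟨a, b, c, hua, hab, hbc, hcu, hub, hac⟩ := hw.exists_eq_of_length_eq_four h
    have hunion : ∀ s t : {s : Finset (Fin 5) // s.card = 2}, s ≠ t → 3 ≤ (s.1 ∪ t.1).card := by
      intro s t hst
      by_contra! hlt
      refine hst (Subtype.ext ?_)
      rw [Finset.eq_of_subset_of_card_le (Finset.subset_union_left (s₁ := s.1) (s₂ := t.1))
        (by rw [s.2]; omega)]
      exact (Finset.eq_of_subset_of_card_le Finset.subset_union_right (by rw [t.2]; omega)).symm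
    have h1 : Disjoint (u.1 ∪ b.1) (a.1 ∪ c.1) := by
      rw [Finset.disjoint_union_left, Finset.disjoint_union_right, Finset.disjoint_union_right]
      exact ⟨⟨hua, hcu.symm⟩, hab.symm, hbc⟩
    have h2 := hcard ((u.1 ∪ b.1) ∪ (a.1 ∪ c.1))
    rw [Finset.card_union_of_disjoint h1] at h2
    have h3 := hunion u b hub
    have h4 := hunion a c hac
    omega
  have : 5 ≤ w.length := by omega
  exact_mod_cast this

theorem ncard_incidenceSet_petersenGraph (s : {s : Finset (Fin 5) // s.card = 2}) :
    (petersenGraph.incidenceSet s).ncard = 3 := by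
  have : DecidableRel petersenGraph.Adj := fun s t => inferInstanceAs (Decidable (Disjoint s.1 t.1))
  have h : ∀ s : {s : Finset (Fin 5) // s.card = 2},
      (Finset.univ.filter fun t : {s : Finset (Fin 5) // s.card = 2} =>
        Disjoint s.1 t.1).card = 3 := by decide
  rw [← Nat.card_coe_set_eq, Nat.card_congr (petersenGraph.incidenceSetEquivNeighborSet s),
    Nat.card_coe_set_eq, ← h s, ← ncard_coe_finset]
  congr 1
  ext t
  simp only [SimpleGraph.mem_neighborSet, Finset.coe_filter, Finset.mem_univ, true_and,
    mem_ofPred_eq]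
  rfl

theorem isCosimple_bicircularMatroid_petersenGraph :
    petersenGraph.bicircularMatroid.IsCosimple :=
  SimpleGraph.isCosimple_bicircularMatroid fun v => (ncard_incidenceSet_petersenGraph v).ge

theorem edgeSet_petersenGraph_nonempty : petersenGraph.edgeSet.Nonempty :=
  ⟨s(⟨{0, 1}, rfl⟩, ⟨{2, 3}, rfl⟩), show Disjoint ({0, 1} : Finset (Fin 5)) {2, 3} by decide⟩

theorem isDoubleCircuitCounterexample_petersenGraph :
    petersenGraph.bicircularMatroid.IsDoubleCircuitCounterexample :=
  SimpleGraph.isDoubleCircuitCounterexample_bicircularMatroid five_le_egirth_petersenGraph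
    isCosimple_bicircularMatroid_petersenGraph edgeSet_petersenGraph_nonempty

end Petersen

theorem corollary3p4 :
    -- not every cosimple gammoid of corank at least two has a positive double circuit
    (¬ ∀ (α : Type) (M : Matroid α), M.IsGammoid → M.IsCosimple → 2 ≤ M.corank →
      M.HasPositiveDoubleCircuit) ∧
    -- not every simple gammoid of rank at least two has a positive coline
    (¬ ∀ (α : Type) (M : Matroid α), M.IsGammoid → M.IsSimple → 2 ≤ M.eRank →
      M.HasPositiveColine) ∧
    -- the equivalence: duality exchanges the two kinds of counterexamples
    (∀ (α : Type u) (M : Matroid α), M.Finite →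
      (M.IsDoubleCircuitCounterexample ↔ M✶.IsColineCounterexample)) ∧
    -- bicircular matroids of graphs of girth at least five have no positive double circuits; those
    -- that are cosimple (and not empty) are counterexamples
    (∀ (V : Type u) (G : SimpleGraph V), Finite V → 5 ≤ G.egirth →
      ∃ B : Matroid (Sym2 V), B.IsBicircularMatroidOf G ∧ ¬ B.HasPositiveDoubleCircuit ∧
        (B.IsCosimple → G.edgeSet.Nonempty →
          B.IsDoubleCircuitCounterexample ∧ B✶.IsColineCounterexample)) ∧
    -- the Petersen graph is an instance
    5 ≤ petersenGraph.egirth ∧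
    ∃ B : Matroid (Sym2 {s : Finset (Fin 5) // s.card = 2}),
      B.IsBicircularMatroidOf petersenGraph ∧ B.IsCosimple ∧
        B.IsDoubleCircuitCounterexample ∧ B✶.IsColineCounterexample := by
  have hP := isDoubleCircuitCounterexample_petersenGraph
  have hP' := Matroid.isDoubleCircuitCounterexample_iff_dual.1 hP
  refine ⟨fun h => ?_, fun h => ?_, fun α M hM => Matroid.isDoubleCircuitCounterexample_iff_dual,
    fun V G hV hG => ⟨G.bicircularMatroid, SimpleGraph.isBicircularMatroidOf_bicircularMatroid,
      SimpleGraph.not_hasPositiveDoubleCircuit_bicircularMatroid hG, fun hcos hne => ?_⟩,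
    five_le_egirth_petersenGraph, petersenGraph.bicircularMatroid,
    SimpleGraph.isBicircularMatroidOf_bicircularMatroid,
    isCosimple_bicircularMatroid_petersenGraph, hP, hP'⟩
  · exact hP.2.2.2 (h _ _ hP.1 hP.2.1 hP.2.2.1)
  · exact hP'.2.2.2 (h _ _ hP'.1 hP'.2.1 hP'.2.2.1)
  · have h1 := SimpleGraph.isDoubleCircuitCounterexample_bicircularMatroid hG hcos hne
    exact ⟨h1, Matroid.isDoubleCircuitCounterexample_iff_dual.1 h1⟩
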